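/- Let $\delta>0$, $a=1+2\delta$, $N_*=a+2=3+2\delta$ and $q_*=2\bigl(1+\tfrac{2}{N_*}\bigr)$; then $q_*>2$. For $R>0$ put $D_R=(0,R)\times(-R,R)$ with points $(r,z)$, $Q_R=D_R\times(-R^2,0)$, and let $d\mu_*=r^a\,dr\,dz$ on $D_R$. Let $W^{1,2}(D_R,\mu_*)$ be the space of $u\in L^2(D_R,\mu_*)$ whose weak derivatives $\partial_r u,\partial_z u$ on $D_R$ lie in $L^2(D_R,\mu_*)$, and write $\nabla=(\partial_r,\partial_z)$. Denote by $\mathcal E_R$ the set of real-valued functions $\psi\in L^\infty\bigl((-R^2,0);L^2(D_R,\mu_*)\bigr)\cap L^2\bigl((-R^2,0);W^{1,2}(D_R,\mu_*)\bigr)$ for which there is a compact set $K\subset[0,R)\times(-R,R)$ such that, for a.e. $t$, $\psi(\cdot,t)=0$ a.e. on $D_R\setminus K$ (for instance, all $\psi$ in this energy class with compact support in $Q_R$). 1. There is a constant $C$ depending only on $\delta$ such that for all $R>0$ and all $\psi\in\mathcal E_R$ $$\|\psi\|_{L^{q_*}(Q_R,\,d\mu_*dt)}\le C\Bigl(\operatorname*{ess\,sup}_{t\in(-R^2,0)}\|\psi(\cdot,t)\|_{L^2(D_R,\mu_*)}+\|\nabla\psi\|_{L^2(Q_R,\,d\mu_*dt)}\Bigr).$$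 2. For all $R>0$, all $p$ with $2\le p<\frac{2N_*}{N_*-2}$ and all $\varepsilon>0$ there is a constant $C_{\varepsilon,p,R}$ (depending only on $\varepsilon,p,R,\delta$) such that for every $\psi\in\mathcal E_R$ and a.e. $t\in(-R^2,0)$ $$\|\psi(\cdot,t)\|_{L^p(D_R,\mu_*)}^2\le\varepsilon\,\|\nabla\psi(\cdot,t)\|_{L^2(D_R,\mu_*)}^2+C_{\varepsilon,p,R}\,\|\psi(\cdot,t)\|_{L^2(D_R,\mu_*)}^2 .$$ -/

import Mathlib

open MeasureTheory Set
open scoped ENNReal NNReal ContDiff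

noncomputable section

namespace RenormalizedGeometry

/-- The weight exponent `a = 1 + 2δ`. -/
def aExp (δ : ℝ) : ℝ := 1 + 2 * δ

/-- The effective dimension `N_* = a + 2`. -/
def Nstar (δ : ℝ) : ℝ := aExp δ + 2

/-- The parabolic exponent `q_* = 2 (1 + 2 / N_*)`. -/
def qstar (δ : ℝ) : ℝ := 2 * (1 + 2 / Nstar δ)

/-- The spatial section `(0,R) × (-R,R)` of the cylinder `Q_R`, in the variables `(r, z)`. -/
def crossSection (R : ℝ) : Set (ℝ × ℝ) := Ioo 0 R ×ˢ Ioo (-R) R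

/-- The time interval `(-R², 0)` of the cylinder `Q_R`. -/
def times (R : ℝ) : Set ℝ := Ioo (-R ^ 2) 0

/-- The measure `dμ_* = r^a dr dz` on the spatial section of `Q_R`. -/
def muStar (δ R : ℝ) : Measure (ℝ × ℝ) :=
  (volume.restrict (crossSection R)).withDensity fun x => ENNReal.ofReal (x.1 ^ aExp δ)

/-- The measure `dμ_* dt` on `Q_R`, points being written `(t, (r, z))`. -/
def muStarTime (δ R : ℝ) : Measure (ℝ × (ℝ × ℝ)) :=
  (volume.restrict (times R)).prod (muStar δ R)

/-- `g` is the weak (distributional) derivative of `u` on `U` in the direction `v`. -/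
def IsWeakDeriv (U : Set (ℝ × ℝ)) (v : ℝ × ℝ) (u g : ℝ × ℝ → ℝ) : Prop :=
  LocallyIntegrableOn u U ∧ LocallyIntegrableOn g U ∧
    ∀ φ : ℝ × ℝ → ℝ, ContDiff ℝ ∞ φ → HasCompactSupport φ → tsupport φ ⊆ U →
      ∫ x in U, u x * fderiv ℝ φ x v = -∫ x in U, g x * φ x

/-- `ψ ∈ L^∞((-R²,0); L²(μ_*)) ∩ L²((-R²,0); W^{1,2}(μ_*))`, with weak spatial derivatives
`∂_r ψ = ψr` and `∂_z ψ = ψz`. -/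
structure EnergyClass (δ R : ℝ) (ψ ψr ψz : ℝ → ℝ × ℝ → ℝ) : Prop where
  memLp : MemLp (fun y : ℝ × (ℝ × ℝ) => ψ y.1 y.2) 2 (muStarTime δ R)
  essSup_lt_top :
    essSup (fun t => eLpNorm (ψ t) 2 (muStar δ R)) (volume.restrict (times R)) < ⊤
  memLp_dr : MemLp (fun y : ℝ × (ℝ × ℝ) => ψr y.1 y.2) 2 (muStarTime δ R)
  memLp_dz : MemLp (fun y : ℝ × (ℝ × ℝ) => ψz y.1 y.2) 2 (muStarTime δ R)
  weak_dr : ∀ᵐ t ∂(volume.restrict (times R)), IsWeakDeriv (crossSection R) (1, 0) (ψ t) (ψr t)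
  weak_dz : ∀ᵐ t ∂(volume.restrict (times R)), IsWeakDeriv (crossSection R) (0, 1) (ψ t) (ψz t)

/-- The support of `ψ` is compact relative to the cylinder with the axis `r = 0` included: all time
slices vanish (a.e.) off one compact subset of `[0,R) × (-R,R)`. This holds in particular when `ψ`
vanishes a.e. off a compact subset of the open cylinder `(0,R) × (-R,R) × (-R²,0)`. -/
def CompactlySupported (R : ℝ) (ψ : ℝ → ℝ × ℝ → ℝ) : Prop :=
  ∃ K : Set (ℝ × ℝ), IsCompact K ∧ K ⊆ Ico 0 R ×ˢ Ioo (-R) R ∧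
    ∀ᵐ t ∂(volume.restrict (times R)), ∀ᵐ x ∂(volume.restrict (crossSection R)), x ∉ K → ψ t x = 0

/-- The Euclidean length `|∇ψ| = (|∂_r ψ|² + |∂_z ψ|²)^{1/2}` of the spatial gradient. -/
def gradLength (ψr ψz : ℝ → ℝ × ℝ → ℝ) (t : ℝ) (x : ℝ × ℝ) : ℝ :=
  Real.sqrt (ψr t x ^ 2 + ψz t x ^ 2)

end RenormalizedGeometry

end

/-! The weight `r ^ a` makes the half plane behave like a space of dimension `N = a + 2`, and
everything follows from the corresponding Sobolev inequality with exponent `2 * (a + 2) / a`. No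
condition on the axis is needed: functions are recovered by integrating in from `r = ∞`, where the
weight is larger.

On a line `z = const`, this gives two bounds for `f` by `∫ |f'| r ^ a`: one for `sup |f| r ^ a`,
and, by Fubini, one for `∫ |f| r ^ (a - 1)`. Hölder combines them with the trivial bound of `|w|` by
`∫ |∂_z w| dz` into an `L¹` Gagliardo–Nirenberg inequality (`lintegral_rpow_le_of_contDiff`).
Applying it to a power of `|v|` and absorbing gives the `L²` Sobolev inequality for `C¹` functions
(`sobolev_of_contDiff`).

Weak derivatives exist only for `r > 0`, so `u` is mollified after a translation by `h` towards the
axis. As the weight is increasing, this does not increase the weighted gradient norm, and Fatou's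
lemma removes first the mollification and then `h`. A cutoff transfers the result to the cross
section (`sobolev_crossSection`).

Finally, Hölder interpolates each time slice between `L²` and the Sobolev exponent. The choice for
which the gradient enters squared can be integrated in time and gives part 1; Young's inequality
gives part 2. -/

noncomputable section

namespace RenormalizedGeometry

/-! ### The weight and one-dimensional inequalities -/

/-- The weight `r₊ ^ b`, which vanishes for `r ≤ 0` when `b > 0`. -/
def weight (b r : ℝ) : ℝ≥0∞ := ENNReal.ofReal r ^ b

theorem measurable_weight (b : ℝ) : Measurable (weight b) :=
  ENNReal.measurable_ofReal.pow_const b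

theorem weight_mono {b : ℝ} (hb : 0 ≤ b) : Monotone (weight b) := fun _ _ h =>
  ENNReal.rpow_le_rpow (ENNReal.ofReal_le_ofReal h) hb

theorem weight_of_nonpos {b r : ℝ} (hb : 0 < b) (hr : r ≤ 0) : weight b r = 0 := by
  simp [weight, ENNReal.ofReal_of_nonpos hr, hb]

theorem weight_of_pos {b r : ℝ} (hr : 0 < r) : weight b r = ENNReal.ofReal (r ^ b) :=
  ENNReal.ofReal_rpow_of_pos hr

/-- Integrating in from infinity rather than out from the axis leaves the value at `r = 0` free. -/
theorem enorm_le_lintegral_Ioi_deriv {f : ℝ → ℝ} (hf : ContDiff ℝ 1 f)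
    (hc : HasCompactSupport f) (r : ℝ) : ‖f r‖ₑ ≤ ∫⁻ s in Ioi r, ‖deriv f s‖ₑ := by
  have hint : Integrable (deriv f) :=
    (hf.continuous_deriv le_rfl).integrable_of_hasCompactSupport hc.deriv
  have h0 : Filter.Tendsto f Filter.atTop (nhds 0) :=
    (hc.is_zero_at_infty).mono_left atTop_le_cocompact
  have h := integral_Ioi_of_hasDerivAt_of_tendsto' (a := r) (f := f) (f' := deriv f)
    (fun x _ => (hf.differentiable one_ne_zero x).hasDerivAt) hint.integrableOn h0
  have : ‖f r‖ₑ = ‖∫ s in Ioi r, deriv f s‖ₑ := by rw [h]; simp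
  rw [this]
  exact enorm_integral_le_lintegral_enorm _

theorem enorm_mul_weight_le {a : ℝ} (ha : 0 ≤ a) {f : ℝ → ℝ} (hf : ContDiff ℝ 1 f)
    (hc : HasCompactSupport f) (r : ℝ) :
    ‖f r‖ₑ * weight a r ≤ ∫⁻ s, ‖deriv f s‖ₑ * weight a s := by
  calc ‖f r‖ₑ * weight a r ≤ (∫⁻ s in Ioi r, ‖deriv f s‖ₑ) * weight a r := by
        gcongr; exact enorm_le_lintegral_Ioi_deriv hf hc r
    _ ≤ ∫⁻ s in Ioi r, ‖deriv f s‖ₑ * weight a r := lintegral_mul_const_le _ _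
    _ ≤ ∫⁻ s in Ioi r, ‖deriv f s‖ₑ * weight a s := by
        refine setLIntegral_mono' measurableSet_Ioi fun s hs => ?_
        gcongr
        exact weight_mono ha (le_of_lt hs)
    _ ≤ _ := setLIntegral_le_lintegral _ _

/-- The integrand is at most its value at the endpoint `s`; the sharp factor `1 / a` is not needed.
-/
theorem lintegral_Iio_weight_le {a : ℝ} (ha : 1 < a) (s : ℝ) :
    ∫⁻ r in Iio s, weight (a - 1) r ≤ weight a s := by
  rcases le_or_gt s 0 with hs | hs
  · rw [setLIntegral_congr_fun (g := fun _ => 0) measurableSet_Iio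
      (fun r hr => weight_of_nonpos (by linarith) (le_of_lt (lt_of_lt_of_le hr hs)))]
    simp
  · calc ∫⁻ r in Iio s, weight (a - 1) r
        = ∫⁻ r in Iic 0 ∪ Ioo 0 s, weight (a - 1) r := by rw [Iic_union_Ioo_eq_Iio hs]
      _ ≤ (∫⁻ r in Iic 0, weight (a - 1) r) + ∫⁻ r in Ioo 0 s, weight (a - 1) r :=
        lintegral_union_le _ _ _
      _ ≤ 0 + ∫⁻ r in Ioo 0 s, weight (a - 1) s := by
        refine add_le_add (le_of_eq ?_) ?_
        · rw [setLIntegral_congr_fun (g := fun _ => 0) measurableSet_Iic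
            (fun r hr => weight_of_nonpos (by linarith) hr)]
          simp
        · exact setLIntegral_mono' measurableSet_Ioo fun r hr =>
            weight_mono (by linarith) hr.2.le
      _ = weight a s := by
        have : a = (a - 1) + 1 := by ring
        rw [zero_add, setLIntegral_const, Real.volume_Ioo, sub_zero]
        conv_rhs => rw [weight, this, ENNReal.rpow_add_of_nonneg _ _ (by linarith) zero_le_one,
          ENNReal.rpow_one]
        rfl

/-- A Hardy inequality: bound `|f r|` by the integral of `|f'|` over `s > r` and exchange the order
of integration. -/
theorem lintegral_enorm_mul_weight_sub_one_le {a : ℝ} (ha : 1 < a) {f : ℝ → ℝ}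
    (hf : ContDiff ℝ 1 f) (hc : HasCompactSupport f) :
    ∫⁻ r, ‖f r‖ₑ * weight (a - 1) r ≤ ∫⁻ s, ‖deriv f s‖ₑ * weight a s := by
  have hm : Measurable fun s => ‖deriv f s‖ₑ := (measurable_deriv f).enorm
  calc ∫⁻ r, ‖f r‖ₑ * weight (a - 1) r
      ≤ ∫⁻ r, ∫⁻ s, (Ioi r).indicator (fun s => ‖deriv f s‖ₑ * weight (a - 1) r) s := by
        refine lintegral_mono fun r => ?_
        simp only
        rw [lintegral_indicator measurableSet_Ioi, lintegral_mul_const _ hm]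
        gcongr
        exact enorm_le_lintegral_Ioi_deriv hf hc r
    _ = ∫⁻ s, ∫⁻ r, (Ioi r).indicator (fun s => ‖deriv f s‖ₑ * weight (a - 1) r) s := by
        refine lintegral_lintegral_swap ?_
        have : (Function.uncurry fun r s =>
            (Ioi r).indicator (fun s => ‖deriv f s‖ₑ * weight (a - 1) r) s) =
            {p : ℝ × ℝ | p.1 < p.2}.indicator
              (fun p => ‖deriv f p.2‖ₑ * weight (a - 1) p.1) := by
          ext p; simp [Function.uncurry, indicator]
        rw [this]
        exact (((hm.comp measurable_snd).mul
          ((measurable_weight _).comp measurable_fst)).indicator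
            (measurableSet_lt measurable_fst measurable_snd)).aemeasurable
    _ = ∫⁻ s, ‖deriv f s‖ₑ * ∫⁻ r in Iio s, weight (a - 1) r := by
        refine lintegral_congr fun s => ?_
        rw [← lintegral_const_mul _ (measurable_weight _), ← lintegral_indicator measurableSet_Iio]
        refine lintegral_congr fun r => ?_
        simp [indicator]
    _ ≤ _ := by
        gcongr with s
        exact lintegral_Iio_weight_le ha s

/-- With `α = a / (a + 1)` and `β = 1 / (a + 1)`, the integrand splits as `(h r ^ (a - 1)) ^ α * (h
r ^ a) ^ β * (h r ^ a) ^ β`, since `α + 2β = (a + 2) / (a + 1)` and `(a - 1) α + 2 a β = a`. One of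
the last two factors is bounded through `g`, the other by `F`, and `α + β = 1` permits Hölder. -/
theorem lintegral_rpow_mul_weight_le {a : ℝ} (ha : 1 < a) {h g : ℝ → ℝ≥0∞} {F : ℝ≥0∞}
    (hh : Measurable h) (hg : Measurable g) (hF : ∀ r, h r * weight a r ≤ F)
    (hH : ∫⁻ r, h r * weight (a - 1) r ≤ F) (hhg : ∀ r, h r ≤ g r) :
    ∫⁻ r, h r ^ ((a + 2) / (a + 1)) * weight a r ≤
      F * (∫⁻ r, g r * weight a r) ^ (1 / (a + 1)) := by
  have ha1 : 0 < a + 1 := by linarith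
  set α := a / (a + 1) with hα
  set β := 1 / (a + 1) with hβ
  have hα0 : 0 ≤ α := by positivity
  have hβ0 : 0 ≤ β := by positivity
  have hαβ : α + β = 1 := by rw [hα, hβ]; field_simp
  have hpt : ∀ r, h r ^ ((a + 2) / (a + 1)) * weight a r ≤
      (h r * weight (a - 1) r) ^ α * (g r * weight a r) ^ β * F ^ β := by
    intro r
    calc h r ^ ((a + 2) / (a + 1)) * weight a r
        = (h r * weight (a - 1) r) ^ α * (h r * weight a r) ^ β * (h r * weight a r) ^ β := by
          have e1 : (a + 2) / (a + 1) = α + β + β := by rw [hα, hβ]; field_simp; ring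
          have e2 : a = (a - 1) * α + a * β + a * β := by rw [hα, hβ]; field_simp; ring
          simp only [weight, ENNReal.mul_rpow_of_nonneg _ _ hα0, ENNReal.mul_rpow_of_nonneg _ _ hβ0,
            ← ENNReal.rpow_mul]
          rw [e1, ENNReal.rpow_add_of_nonneg _ _ (by positivity) hβ0,
            ENNReal.rpow_add_of_nonneg _ _ hα0 hβ0]
          have h1 : 0 ≤ (a - 1) * α := mul_nonneg (by linarith) hα0
          have h2 : 0 ≤ a * β := by positivity
          conv_lhs => rw [e2, ENNReal.rpow_add_of_nonneg _ _ (by positivity) h2,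
            ENNReal.rpow_add_of_nonneg _ _ h1 h2]
          ring
      _ ≤ _ := by
          gcongr
          · exact hhg r
          · exact hF r
  calc ∫⁻ r, h r ^ ((a + 2) / (a + 1)) * weight a r
      ≤ ∫⁻ r, (h r * weight (a - 1) r) ^ α * (g r * weight a r) ^ β * F ^ β :=
        lintegral_mono hpt
    _ = (∫⁻ r, (h r * weight (a - 1) r) ^ α * (g r * weight a r) ^ β) * F ^ β :=
        lintegral_mul_const _ (((hh.mul (measurable_weight _)).pow_const _).mul
          ((hg.mul (measurable_weight _)).pow_const _))
    _ ≤ ((∫⁻ r, h r * weight (a - 1) r) ^ α * (∫⁻ r, g r * weight a r) ^ β) * F ^ β := by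
        gcongr
        exact ENNReal.lintegral_mul_norm_pow_le (hh.mul (measurable_weight _)).aemeasurable
          (hg.mul (measurable_weight _)).aemeasurable hα0 hβ0 hαβ
    _ ≤ (F ^ α * (∫⁻ r, g r * weight a r) ^ β) * F ^ β := by gcongr
    _ = F * (∫⁻ r, g r * weight a r) ^ β := by
        rw [mul_right_comm, ← ENNReal.rpow_add_of_nonneg _ _ hα0 hβ0, hαβ, ENNReal.rpow_one]

/-! ### The `L¹` inequality on the half plane -/

theorem hasDerivAt_slice_fst {w : ℝ × ℝ → ℝ} (hw : ContDiff ℝ 1 w) (r z : ℝ) :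
    HasDerivAt (fun r => w (r, z)) (fderiv ℝ w (r, z) (1, 0)) r :=
  ((hw.differentiable one_ne_zero (r, z)).hasFDerivAt).comp_hasDerivAt r
    ((hasDerivAt_id r).prodMk (hasDerivAt_const r z))

theorem hasDerivAt_slice_snd {w : ℝ × ℝ → ℝ} (hw : ContDiff ℝ 1 w) (r z : ℝ) :
    HasDerivAt (fun z => w (r, z)) (fderiv ℝ w (r, z) (0, 1)) z :=
  ((hw.differentiable one_ne_zero (r, z)).hasFDerivAt).comp_hasDerivAt z
    ((hasDerivAt_const z r).prodMk (hasDerivAt_id z))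

theorem hasCompactSupport_slice_fst {w : ℝ × ℝ → ℝ} (hc : HasCompactSupport w) (z : ℝ) :
    HasCompactSupport fun r => w (r, z) :=
  HasCompactSupport.intro (hc.image continuous_fst) fun _ hr =>
    image_eq_zero_of_notMem_tsupport fun h => hr ⟨_, h, rfl⟩

theorem hasCompactSupport_slice_snd {w : ℝ × ℝ → ℝ} (hc : HasCompactSupport w) (r : ℝ) :
    HasCompactSupport fun z => w (r, z) :=
  HasCompactSupport.intro (hc.image continuous_snd) fun _ hz =>
    image_eq_zero_of_notMem_tsupport fun h => hz ⟨_, h, rfl⟩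

theorem measurable_enorm_fderiv_apply {w : ℝ × ℝ → ℝ} (hw : ContDiff ℝ 1 w) (v : ℝ × ℝ) :
    Measurable fun x => ‖fderiv ℝ w x v‖ₑ :=
  ((hw.continuous_fderiv one_ne_zero).clm_apply continuous_const).measurable.enorm

/-- The weighted Gagliardo–Nirenberg–Sobolev inequality with exponent one on the half plane. -/
theorem lintegral_rpow_le_of_contDiff {a : ℝ} (ha : 1 < a) {w : ℝ × ℝ → ℝ} (hw : ContDiff ℝ 1 w)
    (hc : HasCompactSupport w) :
    ∫⁻ x, ‖w x‖ₑ ^ ((a + 2) / (a + 1)) * weight a x.1 ≤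
      (∫⁻ x, ‖fderiv ℝ w x (1, 0)‖ₑ * weight a x.1) *
        (∫⁻ x, ‖fderiv ℝ w x (0, 1)‖ₑ * weight a x.1) ^ (1 / (a + 1)) := by
  have mW : Measurable fun x : ℝ × ℝ => weight a x.1 := (measurable_weight a).comp measurable_fst
  have mr := measurable_enorm_fderiv_apply hw (1, 0)
  have mz := measurable_enorm_fderiv_apply hw (0, 1)
  have mw : Measurable fun x => ‖w x‖ₑ := hw.continuous.measurable.enorm
  have mrW : Measurable fun x : ℝ × ℝ => ‖fderiv ℝ w x (1, 0)‖ₑ * weight a x.1 := mr.mul mW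
  have mzW : Measurable fun x : ℝ × ℝ => ‖fderiv ℝ w x (0, 1)‖ₑ * weight a x.1 := mz.mul mW
  have mwW : Measurable fun x : ℝ × ℝ => ‖w x‖ₑ ^ ((a + 2) / (a + 1)) * weight a x.1 :=
    (mw.pow_const _).mul mW
  set g : ℝ → ℝ≥0∞ := fun r => ∫⁻ z, ‖fderiv ℝ w (r, z) (0, 1)‖ₑ
  have mg : Measurable g := mz.lintegral_prod_right'
  have hG : ∫⁻ x : ℝ × ℝ, ‖fderiv ℝ w x (0, 1)‖ₑ * weight a x.1 = ∫⁻ r, g r * weight a r := by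
    rw [Measure.volume_eq_prod, lintegral_prod _ mzW.aemeasurable]
    exact lintegral_congr fun r => lintegral_mul_const (weight a r)
      (f := fun z => ‖fderiv ℝ w (r, z) (0, 1)‖ₑ) (mz.comp measurable_prodMk_left)
  rw [hG, Measure.volume_eq_prod,
    lintegral_prod_symm _ mwW.aemeasurable,
    lintegral_prod_symm _ mrW.aemeasurable,
    ← lintegral_mul_const _ mrW.lintegral_prod_left']
  -- On each line `z = const`, `F` is the integral of `|∂_r w| r ^ a` along it, while `g` does not
  -- depend on `z`; integrating in `z` then only affects `F`.
  refine lintegral_mono fun z => ?_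
  have hf : ContDiff ℝ 1 fun r => w (r, z) := hw.comp (contDiff_id.prodMk contDiff_const)
  have hcf := hasCompactSupport_slice_fst hc z
  have hd : deriv (fun r => w (r, z)) = fun r => fderiv ℝ w (r, z) (1, 0) :=
    funext fun r => (hasDerivAt_slice_fst hw r z).deriv
  refine lintegral_rpow_mul_weight_le ha (mw.comp measurable_prodMk_right) mg (fun r => ?_) ?_
    (fun r => ?_)
  · have := enorm_mul_weight_le (a := a) (by linarith) hf hcf r
    rwa [hd] at this
  · have := lintegral_enorm_mul_weight_sub_one_le ha hf hcf
    rwa [hd] at this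
  · have := enorm_le_lintegral_Ioi_deriv (f := fun z => w (r, z))
      (hw.comp (contDiff_const.prodMk contDiff_id)) (hasCompactSupport_slice_snd hc r) z
    rw [show deriv (fun z => w (r, z)) = fun z => fderiv ℝ w (r, z) (0, 1) from
      funext fun z => (hasDerivAt_slice_snd hw r z).deriv] at this
    exact this.trans (setLIntegral_le_lintegral _ _)

/-! ### The `L²` Sobolev inequality for `C¹` functions -/

/-- Absorption: dividing by `I ^ θ` requires `I` to be finite, which
`lintegral_rpow_mul_weight_ne_top` supplies. -/
theorem le_rpow_of_le_mul_rpow {I X : ℝ≥0∞} {θ : ℝ} (h0 : 0 < θ) (h1 : θ < 1) (hI : I ≠ ⊤)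
    (h : I ≤ (I * X) ^ θ) : I ≤ X ^ (θ / (1 - θ)) := by
  rcases eq_or_ne I 0 with rfl | hI0
  · exact zero_le
  have h2 : I ^ θ * I ^ (1 - θ) ≤ I ^ θ * X ^ θ := by
    rw [← ENNReal.rpow_add _ _ hI0 hI, ← ENNReal.mul_rpow_of_nonneg _ _ h0.le]
    simpa using h
  have h3 : I ^ (1 - θ) ≤ X ^ θ :=
    (ENNReal.mul_le_mul_iff_right (by simp [hI0, hI]) (by simp [hI0, hI])).1 h2
  calc I = (I ^ (1 - θ)) ^ (1 / (1 - θ)) := by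
        rw [← ENNReal.rpow_mul, mul_one_div_cancel (by linarith), ENNReal.rpow_one]
    _ ≤ (X ^ θ) ^ (1 / (1 - θ)) :=
        ENNReal.rpow_le_rpow h3 (one_div_nonneg.2 (by linarith))
    _ = _ := by rw [← ENNReal.rpow_mul]; congr 1; ring

theorem enorm_fderiv_norm_rpow_apply_le {v : ℝ × ℝ → ℝ} (hv : Differentiable ℝ v) {s : ℝ}
    (hs : 1 < s) (x e : ℝ × ℝ) :
    ‖fderiv ℝ (fun x => ‖v x‖ ^ s) x e‖ₑ ≤
      ENNReal.ofReal s * (‖v x‖ₑ ^ (s - 1) * ‖fderiv ℝ v x e‖ₑ) := by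
  have h : HasFDerivAt (fun x => ‖v x‖ ^ s) ((s * ‖v x‖ ^ (s - 2) * v x) • fderiv ℝ v x) x :=
    (hasDerivAt_norm_rpow (v x) hs).comp_hasFDerivAt x (hv x).hasFDerivAt
  rw [h.fderiv, smul_apply, smul_eq_mul, enorm_mul, ← mul_assoc]
  gcongr
  rw [← ofReal_norm, ← ofReal_norm,
    ENNReal.ofReal_rpow_of_nonneg (norm_nonneg _) (by linarith), ← ENNReal.ofReal_mul (by linarith)]
  refine ENNReal.ofReal_le_ofReal (le_of_eq ?_)
  rw [norm_mul, norm_mul, Real.norm_of_nonneg (by linarith : 0 ≤ s),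
    Real.norm_of_nonneg (by positivity : 0 ≤ ‖v x‖ ^ (s - 2)), mul_assoc,
    ← Real.rpow_add_one' (norm_nonneg _) (by linarith)]
  ring_nf

theorem lintegral_rpow_mul_weight_ne_top {a p : ℝ} (ha : 0 < a) (hp : 0 < p) {v : ℝ × ℝ → ℝ}
    (hv : Continuous v) (hc : HasCompactSupport v) :
    ∫⁻ x, ‖v x‖ₑ ^ p * weight a x.1 ≠ ⊤ := by
  have hcont : Continuous fun x : ℝ × ℝ => ‖v x‖ ^ p * (max x.1 0) ^ a :=
    (hv.norm.rpow_const fun _ => Or.inr hp.le).mul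
      ((continuous_fst.max continuous_const).rpow_const fun _ => Or.inr ha.le)
  have hcs : HasCompactSupport fun x : ℝ × ℝ => ‖v x‖ ^ p * (max x.1 0) ^ a :=
    HasCompactSupport.intro hc fun x hx => by
      simp [image_eq_zero_of_notMem_tsupport hx, hp.ne']
  have := (hcont.integrable_of_hasCompactSupport hcs (μ := volume)).hasFiniteIntegral
  rw [hasFiniteIntegral_iff_enorm] at this
  refine ((lintegral_congr fun x => ?_).trans_lt this).ne
  rw [enorm_mul, Real.enorm_rpow_of_nonneg (norm_nonneg _) hp.le,
    Real.enorm_rpow_of_nonneg (le_max_right _ _) ha.le, enorm_norm, weight,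
    Real.enorm_of_nonneg (le_max_right _ _)]
  simp [ENNReal.ofReal_max]

/-- The chain rule and Cauchy–Schwarz. With `s = 2 * (a + 1) / a` one has `2 * (s - 1) = 2 * (a + 2)
/ a`, so the Sobolev integral itself reappears on the right. -/
theorem lintegral_enorm_fderiv_norm_rpow_le {a : ℝ} (ha : 0 < a) {v : ℝ × ℝ → ℝ}
    (hv : ContDiff ℝ 1 v) (e : ℝ × ℝ) {M : ℝ≥0∞}
    (hM : ∫⁻ x, ‖fderiv ℝ v x e‖ₑ ^ 2 * weight a x.1 ≤ M) :
    ∫⁻ x, ‖fderiv ℝ (fun x => ‖v x‖ ^ (2 * (a + 1) / a)) x e‖ₑ * weight a x.1 ≤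
      ((∫⁻ x, ‖v x‖ₑ ^ (2 * (a + 2) / a) * weight a x.1) *
        (ENNReal.ofReal (2 * (a + 1) / a) ^ 2 * M)) ^ (1 / 2 : ℝ) := by
  set s := 2 * (a + 1) / a with hs
  have hs2 : 2 < s := by rw [hs, lt_div_iff₀ ha]; linarith
  have hs1 : 2 * (a + 2) / a = 2 * (s - 1) := by rw [hs]; field_simp; ring
  have mW : Measurable fun x : ℝ × ℝ => weight a x.1 := (measurable_weight a).comp measurable_fst
  have mv : Measurable fun x => ‖v x‖ₑ := hv.continuous.measurable.enorm
  have mI : Measurable fun x => ‖v x‖ₑ ^ (2 * (a + 2) / a) * weight a x.1 :=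
    (mv.pow_const _).mul mW
  have mA : Measurable fun x => ‖fderiv ℝ v x e‖ₑ ^ 2 * weight a x.1 :=
    ((measurable_enorm_fderiv_apply hv e).pow_const _).mul mW
  have h2 : (0 : ℝ) ≤ 1 / 2 := by norm_num
  calc ∫⁻ x, ‖fderiv ℝ (fun x => ‖v x‖ ^ s) x e‖ₑ * weight a x.1
      ≤ ∫⁻ x, ENNReal.ofReal s * ((‖v x‖ₑ ^ (2 * (a + 2) / a) * weight a x.1) ^ (1 / 2 : ℝ) *
          (‖fderiv ℝ v x e‖ₑ ^ 2 * weight a x.1) ^ (1 / 2 : ℝ)) := by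
        refine lintegral_mono fun x => ?_
        refine (mul_le_mul_left (enorm_fderiv_norm_rpow_apply_le
          (hv.differentiable one_ne_zero) (by linarith : 1 < s) x e) _).trans (le_of_eq ?_)
        rw [hs1]
        simp only [ENNReal.mul_rpow_of_nonneg _ _ h2, ← ENNReal.rpow_mul, ← ENNReal.rpow_natCast]
        have e1 : 2 * (s - 1) * (1 / 2) = s - 1 := by ring
        have e2 : ((2 : ℕ) : ℝ) * (1 / 2) = 1 := by norm_num
        have e3 : weight a x.1 = weight a x.1 ^ (1 / 2 : ℝ) * weight a x.1 ^ (1 / 2 : ℝ) := by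
          rw [← ENNReal.rpow_add_of_nonneg _ _ h2 h2]; norm_num
        rw [e1, e2, ENNReal.rpow_one]
        conv_lhs => rw [e3]
        ring
    _ = ENNReal.ofReal s * ∫⁻ x, (‖v x‖ₑ ^ (2 * (a + 2) / a) * weight a x.1) ^ (1 / 2 : ℝ) *
          (‖fderiv ℝ v x e‖ₑ ^ 2 * weight a x.1) ^ (1 / 2 : ℝ) :=
        lintegral_const_mul _ (Measurable.mul (f := fun x => _ ^ (1 / 2 : ℝ))
          (g := fun x => _ ^ (1 / 2 : ℝ)) (mI.pow_const _) (mA.pow_const _))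
    _ ≤ ENNReal.ofReal s * ((∫⁻ x, ‖v x‖ₑ ^ (2 * (a + 2) / a) * weight a x.1) ^ (1 / 2 : ℝ) *
          M ^ (1 / 2 : ℝ)) := by
        gcongr
        refine (ENNReal.lintegral_mul_norm_pow_le mI.aemeasurable mA.aemeasurable h2 h2
          (by norm_num)).trans ?_
        gcongr
    _ = _ := by
        simp only [ENNReal.mul_rpow_of_nonneg _ _ h2, ← ENNReal.rpow_mul, ← ENNReal.rpow_natCast]
        norm_num
        ring

/-- The weighted Sobolev inequality on the half plane for continuously differentiable functions,
which need not vanish on the axis. -/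
theorem sobolev_of_contDiff {a : ℝ} (ha : 1 < a) {v : ℝ × ℝ → ℝ} (hv : ContDiff ℝ 1 v)
    (hc : HasCompactSupport v) {M : ℝ≥0∞}
    (hr : ∫⁻ x, ‖fderiv ℝ v x (1, 0)‖ₑ ^ 2 * weight a x.1 ≤ M)
    (hz : ∫⁻ x, ‖fderiv ℝ v x (0, 1)‖ₑ ^ 2 * weight a x.1 ≤ M) :
    ∫⁻ x, ‖v x‖ₑ ^ (2 * (a + 2) / a) * weight a x.1 ≤
      (ENNReal.ofReal (2 * (a + 1) / a) ^ 2 * M) ^ ((a + 2) / a) := by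
  have ha0 : 0 < a := by linarith
  have hs : 1 < 2 * (a + 1) / a := by rw [lt_div_iff₀ ha0]; linarith
  set I := ∫⁻ x, ‖v x‖ₑ ^ (2 * (a + 2) / a) * weight a x.1 with hI
  set X := ENNReal.ofReal (2 * (a + 1) / a) ^ 2 * M with hX
  have hIt : I ≠ ⊤ := lintegral_rpow_mul_weight_ne_top ha0 (by positivity) hv.continuous hc
  set θ := (a + 2) / (2 * (a + 1)) with hθ
  have hθ1 : θ < 1 := by rw [hθ, div_lt_one (by linarith)]; linarith
  -- The power of `|v|` is chosen so that its `(a + 2) / (a + 1)`-th power is the Sobolev power of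
  -- `|v|`.
  have key := lintegral_rpow_le_of_contDiff ha (w := fun x => ‖v x‖ ^ (2 * (a + 1) / a))
    (hv.norm_rpow hs) (hc.comp_left (g := fun y => ‖y‖ ^ (2 * (a + 1) / a))
      (by simp only [norm_zero]; exact Real.zero_rpow (by linarith)))
  have e1 : ∫⁻ x, ‖‖v x‖ ^ (2 * (a + 1) / a)‖ₑ ^ ((a + 2) / (a + 1)) * weight a x.1 = I := by
    refine lintegral_congr fun x => ?_
    rw [Real.enorm_rpow_of_nonneg (norm_nonneg _) (by linarith), enorm_norm, ← ENNReal.rpow_mul]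
    congr 2
    field_simp
  rw [e1] at key
  have h1 : I ≤ (I * X) ^ θ := by
    calc I ≤ (I * X) ^ (1 / 2 : ℝ) * ((I * X) ^ (1 / 2 : ℝ)) ^ (1 / (a + 1)) := by
          refine key.trans ?_
          gcongr
          · exact lintegral_enorm_fderiv_norm_rpow_le ha0 hv _ hr
          · exact lintegral_enorm_fderiv_norm_rpow_le ha0 hv _ hz
      _ = (I * X) ^ θ := by
          rw [← ENNReal.rpow_mul, ← ENNReal.rpow_add_of_nonneg _ _ (by norm_num) (by positivity)]
          congr 1
          rw [hθ]; field_simp; ring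
  refine (le_rpow_of_le_mul_rpow (by positivity) hθ1 hIt h1).trans (le_of_eq ?_)
  congr 1
  have : 1 - θ = a / (2 * (a + 1)) := by rw [hθ]; field_simp; ring
  rw [this, hθ]
  field_simp

/-! ### Mollification shifted towards the axis -/

open scoped Convolution

/-- `g` is the distributional derivative of `u` in the direction `e` on the half plane `r > 0`;
both functions are defined on the whole plane. -/
def IsHalfPlaneWeakDeriv (e : ℝ × ℝ) (u g : ℝ × ℝ → ℝ) : Prop :=
  ∀ φ : ℝ × ℝ → ℝ, ContDiff ℝ ∞ φ → HasCompactSupport φ → tsupport φ ⊆ {x | 0 < x.1} →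
    ∫ x, u x * fderiv ℝ φ x e = -∫ x, g x * φ x

/-- The mollification of `u`, with the part of `u` where `r ≤ h / 2` removed, translated by `h`
towards the axis. -/
def shiftedMollification (ρ : ContDiffBump (0 : ℝ × ℝ)) (h : ℝ) (u : ℝ × ℝ → ℝ) (x : ℝ × ℝ) : ℝ :=
  (({y : ℝ × ℝ | h / 2 < y.1}.indicator u) ⋆[ContinuousLinearMap.lsmul ℝ ℝ, volume]
    ρ.normed volume) (x + (h, 0))

section Mollification

variable {ρ : ContDiffBump (0 : ℝ × ℝ)} {h : ℝ} {u g : ℝ × ℝ → ℝ}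

theorem contDiff_shiftedMollification
    (hu : Integrable ({y : ℝ × ℝ | h / 2 < y.1}.indicator u)) :
    ContDiff ℝ 1 (shiftedMollification ρ h u) := by
  have := ρ.hasCompactSupport_normed (μ := volume) |>.contDiff_convolution_right (n := 1)
    (ContinuousLinearMap.lsmul ℝ ℝ) hu.locallyIntegrable (ρ.contDiff_normed (μ := volume))
  exact this.comp (contDiff_id.add contDiff_const)

theorem hasCompactSupport_shiftedMollification {K : Set (ℝ × ℝ)} (hK : IsCompact K)
    (hu : ∀ x ∉ K, u x = 0) : HasCompactSupport (shiftedMollification ρ h u) := by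
  have h1 : HasCompactSupport ({y : ℝ × ℝ | h / 2 < y.1}.indicator u) :=
    HasCompactSupport.intro hK fun x hx => by simp [indicator, hu x hx]
  have h2 := (h1.convolution (ContinuousLinearMap.lsmul ℝ ℝ) (μ := volume)
    (ρ.hasCompactSupport_normed (μ := volume)))
  exact h2.comp_homeomorph (Homeomorph.addRight ((h, 0) : ℝ × ℝ))

theorem fst_lt_of_normed_ne_zero {x y : ℝ × ℝ} (hρ : ρ.normed volume (x - y) ≠ 0) :
    |x.1 - y.1| < ρ.rOut := by
  have : x - y ∈ Function.support (ρ.normed volume) := hρ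
  rw [ρ.support_normed_eq, mem_ball_zero_iff] at this
  exact (norm_fst_le (x - y)).trans_lt this

/-- For `x.1 > 0` the kernel centred at `x + (h, 0)` lives in `r > h / 2`: it is an admissible test
function, and the truncation of `u` is invisible to it. -/
theorem fderiv_shiftedMollification (hρ : ρ.rOut < h / 2)
    (hu : Integrable ({y : ℝ × ℝ | h / 2 < y.1}.indicator u)) {e : ℝ × ℝ}
    (hg : IsHalfPlaneWeakDeriv e u g) {x : ℝ × ℝ} (hx : 0 < x.1) :
    fderiv ℝ (shiftedMollification ρ h u) x e =
      ∫ y, g y * ρ.normed volume (x + (h, 0) - y) := by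
  set X : ℝ × ℝ := x + (h, 0) with hX
  set n : ℝ × ℝ → ℝ := ρ.normed volume with hn
  have hnc : HasCompactSupport n := ρ.hasCompactSupport_normed
  have hns : ContDiff ℝ ∞ n := ρ.contDiff_normed
  have hns1 : ContDiff ℝ 1 n := hns.of_le (by simp)
  have h1 : fderiv ℝ (shiftedMollification ρ h u) x e =
      ∫ y, {y : ℝ × ℝ | h / 2 < y.1}.indicator u y * fderiv ℝ n (X - y) e := by
    unfold shiftedMollification
    rw [fderiv_comp_add_right, (hnc.hasFDerivAt_convolution_right _ hu.locallyIntegrable hns1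
      (x + (h, 0))).fderiv, convolution_precompR_apply _ hu.locallyIntegrable (hnc.fderiv ℝ)
      (hns1.continuous_fderiv one_ne_zero)]
    rfl
  set φ : ℝ × ℝ → ℝ := fun y => n (X - y) with hφ
  have hφs : ContDiff ℝ ∞ φ := hns.comp (contDiff_const.sub contDiff_id)
  have hφd : ∀ y, fderiv ℝ φ y e = -fderiv ℝ n (X - y) e := by
    intro y
    have := ((hns1.differentiable one_ne_zero (X - y)).hasFDerivAt).comp y
      ((hasFDerivAt_const X y).sub (hasFDerivAt_id y))
    rw [show fderiv ℝ φ y = _ from this.fderiv]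
    simp
  have hφt : tsupport φ ⊆ Metric.closedBall X ρ.rOut := by
    refine closure_minimal (fun y hy => ?_) Metric.isClosed_closedBall
    have : X - y ∈ Function.support n := hy
    rw [hn, ρ.support_normed_eq, mem_ball_zero_iff] at this
    rw [mem_closedBall_iff_norm']
    exact this.le
  have hφc : HasCompactSupport φ :=
    (isCompact_closedBall X ρ.rOut).of_isClosed_subset (isClosed_tsupport _) hφt
  have hφr : ∀ y ∈ tsupport φ, h / 2 < y.1 := by
    intro y hy
    have h3 := hφt hy
    rw [mem_closedBall_iff_norm'] at h3
    have h4 := (norm_fst_le (X - y)).trans h3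
    rw [Real.norm_eq_abs] at h4
    have h5 := (abs_le.1 h4).2
    simp only [hX, Prod.fst_sub, Prod.fst_add] at h5
    linarith
  have hh : 0 < h := by linarith [ρ.rOut_pos]
  have h2 := hg φ hφs hφc fun y hy => (by positivity : 0 < h / 2).trans (hφr y hy)
  rw [h1]
  have h3 : ∀ y, {y : ℝ × ℝ | h / 2 < y.1}.indicator u y * fderiv ℝ n (X - y) e =
      -(u y * fderiv ℝ φ y e) := by
    intro y
    by_cases hy : h / 2 < y.1
    · rw [indicator_of_mem (by exact hy), hφd]; ring
    · have h0 : fderiv ℝ φ y e = 0 := by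
        rw [image_eq_zero_of_notMem_tsupport (f := fderiv ℝ φ)
          fun hy' => hy (hφr y (tsupport_fderiv_subset ℝ hy'))]
        rfl
      have h0' : fderiv ℝ n (X - y) e = 0 := by rw [hφd] at h0; linarith
      rw [h0, h0']; simp
  simp_rw [h3]
  rw [integral_neg, h2, neg_neg]

theorem lintegral_normed_eq_one : ∫⁻ x, ENNReal.ofReal (ρ.normed volume x) = 1 := by
  rw [← ofReal_integral_eq_lintegral_ofReal ρ.integrable_normed
    (Filter.Eventually.of_forall ρ.nonneg_normed), ρ.integral_normed, ENNReal.ofReal_one]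

/-- Cauchy–Schwarz against the probability density `ρ.normed volume (X - ·)`. -/
theorem enorm_integral_mul_normed_sq_le (hg : AEStronglyMeasurable g) (X : ℝ × ℝ) :
    ‖∫ y, g y * ρ.normed volume (X - y)‖ₑ ^ 2 ≤
      ∫⁻ y, ‖g y‖ₑ ^ 2 * ENNReal.ofReal (ρ.normed volume (X - y)) := by
  have mn : Measurable fun y => ENNReal.ofReal (ρ.normed volume (X - y)) :=
    (ρ.continuous_normed.comp (continuous_const.sub continuous_id)).measurable.ennreal_ofReal
  have h2 : (0 : ℝ) ≤ 1 / 2 := by norm_num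
  have hone : ∫⁻ y, ENNReal.ofReal (ρ.normed volume (X - y)) = 1 := by
    rw [lintegral_sub_left_eq_self (fun y => ENNReal.ofReal (ρ.normed volume y)) X,
      lintegral_normed_eq_one]
  have hE : ‖∫ y, g y * ρ.normed volume (X - y)‖ₑ ≤
      (∫⁻ y, ‖g y‖ₑ ^ 2 * ENNReal.ofReal (ρ.normed volume (X - y))) ^ (1 / 2 : ℝ) := by
    calc ‖∫ y, g y * ρ.normed volume (X - y)‖ₑ
        ≤ ∫⁻ y, ‖g y * ρ.normed volume (X - y)‖ₑ := enorm_integral_le_lintegral_enorm _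
      _ = ∫⁻ y, (‖g y‖ₑ ^ 2 * ENNReal.ofReal (ρ.normed volume (X - y))) ^ (1 / 2 : ℝ) *
            ENNReal.ofReal (ρ.normed volume (X - y)) ^ (1 / 2 : ℝ) := by
          refine lintegral_congr fun y => ?_
          rw [enorm_mul, Real.enorm_of_nonneg (ρ.nonneg_normed _),
            ENNReal.mul_rpow_of_nonneg _ _ h2, mul_assoc,
            ← ENNReal.rpow_add_of_nonneg _ _ h2 h2, ← ENNReal.rpow_natCast, ← ENNReal.rpow_mul]
          norm_num
      _ ≤ _ := by
          refine (ENNReal.lintegral_mul_norm_pow_le ((hg.enorm.pow_const 2).mul mn.aemeasurable)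
            mn.aemeasurable h2 h2 (by norm_num)).trans (le_of_eq ?_)
          rw [hone, ENNReal.one_rpow, mul_one]
          rfl
  calc _ ≤ ((∫⁻ y, ‖g y‖ₑ ^ 2 * ENNReal.ofReal (ρ.normed volume (X - y))) ^ (1 / 2 : ℝ)) ^ 2 := by
        gcongr
    _ = _ := by rw [← ENNReal.rpow_natCast, ← ENNReal.rpow_mul]; norm_num

theorem lintegral_fderiv_shiftedMollification_le {a : ℝ} (ha : 0 < a) (hρ : ρ.rOut < h / 2)
    (hu : Integrable ({y : ℝ × ℝ | h / 2 < y.1}.indicator u)) {e : ℝ × ℝ}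
    (hgm : AEStronglyMeasurable g) (hg : IsHalfPlaneWeakDeriv e u g) :
    ∫⁻ x, ‖fderiv ℝ (shiftedMollification ρ h u) x e‖ₑ ^ 2 * weight a x.1 ≤
      ∫⁻ y, ‖g y‖ₑ ^ 2 * weight a y.1 := by
  have mW : Measurable fun x : ℝ × ℝ => weight a x.1 := (measurable_weight a).comp measurable_fst
  have mn : Measurable fun p : (ℝ × ℝ) × (ℝ × ℝ) =>
      ENNReal.ofReal (ρ.normed volume (p.1 + (h, 0) - p.2)) :=
    (ρ.continuous_normed.comp
      ((continuous_fst.add continuous_const).sub continuous_snd)).measurable.ennreal_ofReal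
  calc ∫⁻ x, ‖fderiv ℝ (shiftedMollification ρ h u) x e‖ₑ ^ 2 * weight a x.1
      ≤ ∫⁻ x : ℝ × ℝ, ∫⁻ y, ‖g y‖ₑ ^ 2 *
          (ENNReal.ofReal (ρ.normed volume (x + (h, 0) - y)) * weight a x.1) := by
        refine lintegral_mono fun x => ?_
        rcases le_or_gt x.1 0 with hx | hx
        · simp [weight_of_nonpos ha hx]
        · simp only [← mul_assoc]
          refine le_trans ?_ (lintegral_mul_const_le _ _)
          rw [fderiv_shiftedMollification hρ hu hg hx]
          gcongr
          exact enorm_integral_mul_normed_sq_le hgm _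
    _ = ∫⁻ y, ∫⁻ x : ℝ × ℝ, ‖g y‖ₑ ^ 2 *
          (ENNReal.ofReal (ρ.normed volume (x + (h, 0) - y)) * weight a x.1) := by
        refine lintegral_lintegral_swap ?_
        refine AEMeasurable.mul (f := fun p : (ℝ × ℝ) × (ℝ × ℝ) => ‖g p.2‖ₑ ^ 2)
          (g := fun p : (ℝ × ℝ) × (ℝ × ℝ) =>
            ENNReal.ofReal (ρ.normed volume (p.1 + (h, 0) - p.2)) * weight a p.1.1) ?_ ?_
        · exact (hgm.enorm.pow_const 2).comp_quasiMeasurePreserving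
            Measure.quasiMeasurePreserving_snd
        · exact (mn.mul (mW.comp measurable_fst)).aemeasurable
    _ ≤ ∫⁻ y, ‖g y‖ₑ ^ 2 * weight a y.1 := by
        refine lintegral_mono fun y => ?_
        have mn' : Measurable fun x : ℝ × ℝ =>
            ENNReal.ofReal (ρ.normed volume (x + (h, 0) - y)) :=
          (ρ.continuous_normed.comp ((continuous_id.add continuous_const).sub
            continuous_const)).measurable.ennreal_ofReal
        simp only
        have mnW : Measurable fun x : ℝ × ℝ =>
            ENNReal.ofReal (ρ.normed volume (x + (h, 0) - y)) * weight a x.1 := mn'.mul mW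
        rw [lintegral_const_mul _ mnW]
        gcongr
        calc ∫⁻ x : ℝ × ℝ, ENNReal.ofReal (ρ.normed volume (x + (h, 0) - y)) * weight a x.1
            ≤ ∫⁻ x : ℝ × ℝ, ENNReal.ofReal (ρ.normed volume (x + (h, 0) - y)) * weight a y.1 := by
              refine lintegral_mono fun x => ?_
              -- Where the kernel is nonzero, `x.1 < y.1 - h + ρ.rOut < y.1`, so monotonicity moves
              -- the weight from `x` to `y`.
              by_cases h0 : ρ.normed volume (x + (h, 0) - y) = 0
              · simp [h0]
              · have h1 := (abs_lt.1 (fst_lt_of_normed_ne_zero h0)).2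
                simp only [Prod.fst_add] at h1
                dsimp only
                gcongr
                exact weight_mono ha.le (by linarith [ρ.rOut_pos])
          _ = weight a y.1 := by
              rw [lintegral_mul_const _ mn']
              have : ∫⁻ x : ℝ × ℝ, ENNReal.ofReal (ρ.normed volume (x + (h, 0) - y)) = 1 := by
                simp only [add_sub_assoc]
                rw [lintegral_add_right_eq_self
                  (fun x => ENNReal.ofReal (ρ.normed volume x)) ((h, 0) - y),
                  lintegral_normed_eq_one]
              rw [this, one_mul]

end Mollification

/-! ### Passage to the limit for weak derivatives -/

/-- Fatou's lemma for an almost everywhere convergent sequence with bounded integrals. -/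
theorem lintegral_le_of_ae_tendsto {α : Type*} [MeasurableSpace α] {μ : Measure α}
    {f : ℕ → α → ℝ≥0∞} {F : α → ℝ≥0∞} {B : ℝ≥0∞} (hf : ∀ n, AEMeasurable (f n) μ)
    (hlim : ∀ᵐ x ∂μ, Filter.Tendsto (fun n => f n x) Filter.atTop (nhds (F x)))
    (hB : ∀ n, ∫⁻ x, f n x ∂μ ≤ B) : ∫⁻ x, F x ∂μ ≤ B :=
  calc ∫⁻ x, F x ∂μ = ∫⁻ x, Filter.liminf (fun n => f n x) Filter.atTop ∂μ :=
        lintegral_congr_ae (hlim.mono fun _ h => h.liminf_eq.symm)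
    _ ≤ Filter.liminf (fun n => ∫⁻ x, f n x ∂μ) Filter.atTop := lintegral_liminf_le' hf
    _ ≤ B := by
        refine (Filter.liminf_le_liminf (Filter.Eventually.of_forall hB)).trans ?_
        simp

theorem tendsto_weight (b r : ℝ) {h : ℕ → ℝ}
    (hh : Filter.Tendsto h Filter.atTop (nhds 0)) :
    Filter.Tendsto (fun n => weight b (r - h n)) Filter.atTop (nhds (weight b r)) := by
  have h1 : Filter.Tendsto (fun n => r - h n) Filter.atTop (nhds r) := by
    simpa using tendsto_const_nhds.sub hh
  exact (ENNReal.continuous_rpow_const.tendsto _).comp ((ENNReal.tendsto_ofReal h1))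

/-- A bump function at the origin of prescribed outer radius, twice its inner radius. -/
def bumpOfRadius (η : ℝ) (hη : 0 < η) : ContDiffBump (0 : ℝ × ℝ) where
  rIn := η / 2
  rOut := η
  rIn_pos := by positivity
  rIn_lt_rOut := by linarith

/-- The weighted Sobolev inequality on a half plane whose weight is centred at distance `h` inside
the domain. -/
theorem sobolev_shifted {a : ℝ} (ha : 1 < a) {u gr gz : ℝ × ℝ → ℝ} {K : Set (ℝ × ℝ)}
    (hK : IsCompact K) (huK : ∀ x ∉ K, u x = 0)
    (hu : ∀ c : ℝ, 0 < c → Integrable ({y : ℝ × ℝ | c < y.1}.indicator u))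
    (hgrm : AEStronglyMeasurable gr) (hgzm : AEStronglyMeasurable gz)
    (hgr : IsHalfPlaneWeakDeriv (1, 0) u gr) (hgz : IsHalfPlaneWeakDeriv (0, 1) u gz) {M : ℝ≥0∞}
    (hr : ∫⁻ x, ‖gr x‖ₑ ^ 2 * weight a x.1 ≤ M) (hz : ∫⁻ x, ‖gz x‖ₑ ^ 2 * weight a x.1 ≤ M)
    {h : ℝ} (hh : 0 < h) :
    ∫⁻ x, ‖u x‖ₑ ^ (2 * (a + 2) / a) * weight a (x.1 - h) ≤
      (ENNReal.ofReal (2 * (a + 1) / a) ^ 2 * M) ^ ((a + 2) / a) := by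
  have ha0 : 0 < a := by linarith
  have hp : 0 < 2 * (a + 2) / a := by positivity
  have mW : Measurable fun x : ℝ × ℝ => weight a x.1 := (measurable_weight a).comp measurable_fst
  set U := {y : ℝ × ℝ | h / 2 < y.1}.indicator u with hU
  have hUi : Integrable U := hu _ (by positivity)
  -- The radii `h / (4 (n + 1))` tend to zero and stay below `h / 2`.
  have hη : ∀ n : ℕ, 0 < h / 4 * (1 / ((n : ℝ) + 1)) := fun n => by positivity
  set ρ : ℕ → ContDiffBump (0 : ℝ × ℝ) := fun n => bumpOfRadius _ (hη n) with hρ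
  have hρh : ∀ n, (ρ n).rOut < h / 2 := by
    intro n
    change h / 4 * (1 / ((n : ℝ) + 1)) < h / 2
    have : 1 / ((n : ℝ) + 1) ≤ 1 := by
      rw [div_le_one (by positivity)]; linarith [n.cast_nonneg (α := ℝ)]
    nlinarith
  have hρ0 : Filter.Tendsto (fun n => (ρ n).rOut) Filter.atTop (nhds 0) := by
    have := (tendsto_one_div_add_atTop_nhds_zero_nat (𝕜 := ℝ)).const_mul (h / 4)
    rwa [mul_zero] at this
  have hconv : ∀ᵐ x : ℝ × ℝ, Filter.Tendsto (fun n => shiftedMollification (ρ n) h u x)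
      Filter.atTop (nhds (U (x + (h, 0)))) := by
    have h1 := ContDiffBump.ae_convolution_tendsto_right_of_locallyIntegrable (K := 2) hρ0
      (Filter.Eventually.of_forall fun n => by
        change h / 4 * (1 / ((n : ℝ) + 1)) ≤ 2 * (h / 4 * (1 / ((n : ℝ) + 1)) / 2)
        linarith) hUi.locallyIntegrable
    have h2 := (measurePreserving_add_right (volume : Measure (ℝ × ℝ))
      (h, 0)).quasiMeasurePreserving.ae h1
    filter_upwards [h2] with x hx
    refine hx.congr fun n => ?_
    rw [shiftedMollification, convolution_lsmul_swap, convolution_lsmul]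
    simp only [smul_eq_mul, mul_comm]
    rfl
  have hlim : ∫⁻ x : ℝ × ℝ, ‖U (x + (h, 0))‖ₑ ^ (2 * (a + 2) / a) * weight a x.1 ≤
      (ENNReal.ofReal (2 * (a + 1) / a) ^ 2 * M) ^ ((a + 2) / a) := by
    refine lintegral_le_of_ae_tendsto
      (f := fun n x => ‖shiftedMollification (ρ n) h u x‖ₑ ^ (2 * (a + 2) / a) * weight a x.1)
      (fun n => ?_) ?_ (fun n => ?_)
    · exact (((contDiff_shiftedMollification hUi).continuous.measurable.enorm.pow_const _).mul
        mW).aemeasurable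
    · filter_upwards [hconv] with x hx
      refine ENNReal.Tendsto.mul_const ?_ (Or.inr ?_)
      · exact (ENNReal.continuous_rpow_const.tendsto _).comp
          ((continuous_enorm.tendsto _).comp hx)
      · exact ENNReal.rpow_ne_top_of_nonneg ha0.le ENNReal.ofReal_ne_top
    · exact sobolev_of_contDiff ha (contDiff_shiftedMollification hUi)
        (hasCompactSupport_shiftedMollification hK huK)
        ((lintegral_fderiv_shiftedMollification_le ha0 (hρh n) hUi hgrm hgr).trans hr)
        ((lintegral_fderiv_shiftedMollification_le ha0 (hρh n) hUi hgzm hgz).trans hz)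
  refine le_trans (le_of_eq ?_) hlim
  -- Undo the translation: where the weight is positive, the argument of `U` has first coordinate
  -- above `h`, so `U = u` there.
  rw [← lintegral_add_right_eq_self _ ((h, 0) : ℝ × ℝ)]
  refine lintegral_congr fun x => ?_
  simp only [Prod.fst_add, add_sub_cancel_right]
  rcases le_or_gt x.1 0 with hx | hx
  · simp [weight_of_nonpos ha0 hx]
  · rw [hU, indicator_of_mem]
    simp only [mem_ofPred_eq, Prod.fst_add]
    linarith

/-- The weighted Sobolev inequality for functions with weak derivatives on the half plane. -/
theorem sobolev_halfPlane {a : ℝ} (ha : 1 < a) {u gr gz : ℝ × ℝ → ℝ} {K : Set (ℝ × ℝ)}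
    (hK : IsCompact K) (huK : ∀ x ∉ K, u x = 0) (hum : AEStronglyMeasurable u)
    (hu : ∀ c : ℝ, 0 < c → Integrable ({y : ℝ × ℝ | c < y.1}.indicator u))
    (hgrm : AEStronglyMeasurable gr) (hgzm : AEStronglyMeasurable gz)
    (hgr : IsHalfPlaneWeakDeriv (1, 0) u gr) (hgz : IsHalfPlaneWeakDeriv (0, 1) u gz) {M : ℝ≥0∞}
    (hr : ∫⁻ x, ‖gr x‖ₑ ^ 2 * weight a x.1 ≤ M) (hz : ∫⁻ x, ‖gz x‖ₑ ^ 2 * weight a x.1 ≤ M) :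
    ∫⁻ x, ‖u x‖ₑ ^ (2 * (a + 2) / a) * weight a x.1 ≤
      (ENNReal.ofReal (2 * (a + 1) / a) ^ 2 * M) ^ ((a + 2) / a) := by
  have hp : 0 < 2 * (a + 2) / a := by positivity
  -- The bound is uniform in the shift, so Fatou applies along `h = 1 / (n + 1)`.
  refine lintegral_le_of_ae_tendsto
    (f := fun n x => ‖u x‖ₑ ^ (2 * (a + 2) / a) * weight a (x.1 - 1 / ((n : ℝ) + 1)))
    (fun n => ?_) (Filter.Eventually.of_forall fun x => ?_) (fun n => ?_)
  · exact (hum.enorm.pow_const _).mul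
      ((measurable_weight a).comp (measurable_fst.sub_const _)).aemeasurable
  · refine ENNReal.Tendsto.const_mul (tendsto_weight a x.1
      tendsto_one_div_add_atTop_nhds_zero_nat) (Or.inr ?_)
    exact ENNReal.rpow_ne_top_of_nonneg hp.le enorm_ne_top
  · exact sobolev_shifted ha hK huK hu hgrm hgzm hgr hgz hr hz (by positivity)

/-! ### Transfer to the cross section -/

theorem measurableSet_crossSection (R : ℝ) : MeasurableSet (crossSection R) :=
  measurableSet_Ioo.prod measurableSet_Ioo

instance sFinite_muStar (δ R : ℝ) : SFinite (muStar δ R) := by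
  unfold muStar; infer_instance

theorem lintegral_muStar (δ R : ℝ) (F : ℝ × ℝ → ℝ≥0∞) :
    ∫⁻ x, F x ∂(muStar δ R) =
      ∫⁻ x, (crossSection R).indicator (fun x => F x * weight (aExp δ) x.1) x := by
  have m : Measurable fun x : ℝ × ℝ => ENNReal.ofReal (x.1 ^ aExp δ) :=
    (measurable_fst.pow_const _).ennreal_ofReal
  rw [muStar, lintegral_withDensity_eq_lintegral_mul_non_measurable _ m
    (Filter.Eventually.of_forall fun _ => ENNReal.ofReal_lt_top),
    lintegral_indicator (measurableSet_crossSection R)]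
  refine setLIntegral_congr_fun (measurableSet_crossSection R) fun x hx => ?_
  simp only [Pi.mul_apply]
  rw [weight_of_pos hx.1.1, mul_comm]

theorem aestronglyMeasurable_muStar {δ R : ℝ} {u : ℝ × ℝ → ℝ}
    (hu : LocallyIntegrableOn u (crossSection R)) : AEStronglyMeasurable u (muStar δ R) :=
  hu.aestronglyMeasurable.mono_ac (withDensity_absolutelyContinuous _ _)

/-- A smooth cutoff function adapted to a compact subset of an open set. -/
theorem exists_cutoff {K O : Set (ℝ × ℝ)} (hK : IsClosed K) (hO : IsOpen O) (hKO : K ⊆ O) :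
    ∃ χ : ℝ × ℝ → ℝ, ContDiff ℝ ∞ χ ∧ tsupport χ ⊆ O ∧ (∀ x ∈ K, χ =ᶠ[nhds x] 1) ∧
      ∀ x, χ x ∈ Icc (0 : ℝ) 1 := by
  obtain ⟨f, h0, h1, hf⟩ := exists_contMDiffMap_zero_one_nhds_of_isClosed (n := (⊤ : ℕ∞))
    (modelWithCornersSelf ℝ (ℝ × ℝ)) hO.isClosed_compl hK
    (disjoint_compl_left_iff_subset.2 hKO)
  refine ⟨f, f.contMDiff.contDiff, fun x hx => ?_, fun x hx => ?_, hf⟩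
  · by_contra hxO
    exact (notMem_tsupport_iff_eventuallyEq.2 (eventually_nhdsSet_iff_forall.1 h0 x hxO)) hx
  · exact eventually_nhdsSet_iff_forall.1 h1 x hx

theorem integral_indicator_mul {D : Set (ℝ × ℝ)} (hD : MeasurableSet D) (f φ : ℝ × ℝ → ℝ) :
    ∫ x, D.indicator f x * φ x = ∫ x in D, f x * φ x := by
  rw [← integral_indicator hD]
  refine integral_congr_ae (Filter.Eventually.of_forall fun x => ?_)
  by_cases hx : x ∈ D <;> simp [hx]

section Slice

variable {R : ℝ} {K : Set (ℝ × ℝ)} {u g χ : ℝ × ℝ → ℝ}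

/-- The extension by zero of a function supported in `K`, and of its weak derivative cut off away
from `K`, has a weak derivative on the whole half plane. -/
theorem isHalfPlaneWeakDeriv_indicator {e : ℝ × ℝ}
    (huK : ∀ᵐ x ∂(volume.restrict (crossSection R)), x ∉ K → u x = 0)
    (hχ : ContDiff ℝ ∞ χ) (hχs : tsupport χ ⊆ Iio R ×ˢ Ioo (-R) R)
    (hχ1 : ∀ x ∈ K, χ =ᶠ[nhds x] 1) (hg : IsWeakDeriv (crossSection R) e u g) :
    IsHalfPlaneWeakDeriv e ((crossSection R).indicator (K.indicator u))
      ((crossSection R).indicator fun x => χ x * g x) := by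
  intro φ hφ hφc hφt
  have hD := measurableSet_crossSection R
  have hsub : tsupport (fun x => χ x * φ x) ⊆ crossSection R := by
    intro x hx
    have h1 := hχs (tsupport_mul_subset_left hx)
    have h2 : 0 < x.1 := hφt (tsupport_mul_subset_right hx)
    exact ⟨⟨h2, h1.1⟩, h1.2⟩
  have key := hg.2.2 (fun x => χ x * φ x) (hχ.mul hφ) hφc.mul_left hsub
  -- On `K` the cutoff is `1` near the point, so `χ * φ` and `φ` have the same derivative; off `K`
  -- the function `u` vanishes.
  have e1 : ∫ x, (crossSection R).indicator (K.indicator u) x * fderiv ℝ φ x e =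
      ∫ x in crossSection R, u x * fderiv ℝ (fun x => χ x * φ x) x e := by
    rw [integral_indicator_mul hD]
    refine integral_congr_ae ?_
    filter_upwards [huK] with x hx
    by_cases hxK : x ∈ K
    · have : (fun x => χ x * φ x) =ᶠ[nhds x] φ := by
        filter_upwards [hχ1 x hxK] with y hy
        simp [hy]
      rw [this.fderiv_eq, indicator_of_mem hxK]
    · rw [hx hxK, indicator_of_notMem hxK]; simp
  have e2 : ∫ x, (crossSection R).indicator (fun x => χ x * g x) x * φ x =
      ∫ x in crossSection R, g x * (χ x * φ x) := by
    rw [integral_indicator_mul hD]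
    exact integral_congr_ae (Filter.Eventually.of_forall fun x => by ring)
  rw [e1, e2, key]

/-- `K` may touch the axis, where local integrability says nothing; its part with `r ≥ c` is compact
inside the open section. -/
theorem integrable_indicator_of_locallyIntegrableOn (hK : IsCompact K)
    (hKs : K ⊆ Ico 0 R ×ˢ Ioo (-R) R) (hu : LocallyIntegrableOn u (crossSection R)) {c : ℝ}
    (hc : 0 < c) :
    Integrable ({y : ℝ × ℝ | c < y.1}.indicator ((crossSection R).indicator (K.indicator u))) := by
  have hcl : IsClosed {y : ℝ × ℝ | c ≤ y.1} := isClosed_le continuous_const continuous_fst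
  have hK' : IsCompact (K ∩ {y : ℝ × ℝ | c ≤ y.1}) := hK.inter_right hcl
  have hsub : K ∩ {y : ℝ × ℝ | c ≤ y.1} ⊆ crossSection R := fun x hx =>
    ⟨⟨hc.trans_le hx.2, (hKs hx.1).1.2⟩, (hKs hx.1).2⟩
  have hi := hu.integrableOn_compact_subset hsub hK'
  rw [indicator_indicator, indicator_indicator, integrable_indicator_iff]
  · exact hi.mono_set fun x hx => ⟨hx.2, show c ≤ x.1 from le_of_lt hx.1.1⟩
  · exact ((measurableSet_lt measurable_const measurable_fst).inter
      (measurableSet_crossSection R)).inter hK.measurableSet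

theorem lintegral_cutoff_le {δ : ℝ} {G : ℝ × ℝ → ℝ} (hχ : ∀ x, χ x ∈ Icc (0 : ℝ) 1)
    (hG : ∀ x, |g x| ≤ |G x|) :
    ∫⁻ x, ‖(crossSection R).indicator (fun x => χ x * g x) x‖ₑ ^ 2 * weight (aExp δ) x.1 ≤
      ∫⁻ x, ‖G x‖ₑ ^ 2 ∂(muStar δ R) := by
  rw [lintegral_muStar]
  refine lintegral_mono fun x => ?_
  by_cases hx : x ∈ crossSection R
  · simp only [indicator_of_mem hx]
    gcongr
    rw [enorm_le_iff_norm_le, norm_mul, Real.norm_of_nonneg (hχ x).1]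
    exact (mul_le_of_le_one_left (norm_nonneg _) (hχ x).2).trans (hG x)
  · simp [indicator_of_notMem hx]

/-- The weighted Sobolev inequality on the cross section, for functions that vanish near its outer
boundary but not necessarily near the axis. -/
theorem sobolev_crossSection {δ : ℝ} (hδ : 0 < δ) {gr gz : ℝ × ℝ → ℝ} (hK : IsCompact K)
    (hKs : K ⊆ Ico 0 R ×ˢ Ioo (-R) R)
    (huK : ∀ᵐ x ∂(volume.restrict (crossSection R)), x ∉ K → u x = 0)
    (hgr : IsWeakDeriv (crossSection R) (1, 0) u gr)
    (hgz : IsWeakDeriv (crossSection R) (0, 1) u gz) :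
    ∫⁻ x, ‖u x‖ₑ ^ (2 * (aExp δ + 2) / aExp δ) ∂(muStar δ R) ≤
      (ENNReal.ofReal (2 * (aExp δ + 1) / aExp δ) ^ 2 *
        ∫⁻ x, ‖Real.sqrt (gr x ^ 2 + gz x ^ 2)‖ₑ ^ 2 ∂(muStar δ R)) ^
          ((aExp δ + 2) / aExp δ) := by
  have ha : 1 < aExp δ := by unfold aExp; linarith
  have hp : 0 < 2 * (aExp δ + 2) / aExp δ := by positivity
  have hD := measurableSet_crossSection R
  obtain ⟨χ, hχ, hχs, hχ1, hχ01⟩ := exists_cutoff (O := Iio R ×ˢ Ioo (-R) R) hK.isClosed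
    (isOpen_Iio.prod isOpen_Ioo) fun x hx => ⟨(hKs hx).1.2, (hKs hx).2⟩
  have hmeas : ∀ {g : ℝ × ℝ → ℝ}, LocallyIntegrableOn g (crossSection R) →
      AEStronglyMeasurable ((crossSection R).indicator fun x => χ x * g x) := fun hg =>
    (aestronglyMeasurable_indicator_iff hD).2
      (hχ.continuous.aestronglyMeasurable.mul hg.aestronglyMeasurable)
  have hu0 : ∀ x ∉ K, (crossSection R).indicator (K.indicator u) x = 0 := fun x hx => by
    simp [indicator, hx]
  have hum : AEStronglyMeasurable ((crossSection R).indicator (K.indicator u)) :=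
    (aestronglyMeasurable_indicator_iff hD).2
      (hgr.1.aestronglyMeasurable.indicator hK.measurableSet)
  have key := sobolev_halfPlane ha hK hu0 hum
    (fun c hc => integrable_indicator_of_locallyIntegrableOn hK hKs hgr.1 hc)
    (hmeas hgr.2.1) (hmeas hgz.2.1)
    (isHalfPlaneWeakDeriv_indicator huK hχ hχs hχ1 hgr)
    (isHalfPlaneWeakDeriv_indicator huK hχ hχs hχ1 hgz)
    (lintegral_cutoff_le (δ := δ) (G := fun x => Real.sqrt (gr x ^ 2 + gz x ^ 2)) hχ01 fun x => by
      rw [abs_of_nonneg (Real.sqrt_nonneg _)]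
      exact Real.abs_le_sqrt (by nlinarith [sq_nonneg (gz x)]))
    (lintegral_cutoff_le (δ := δ) (G := fun x => Real.sqrt (gr x ^ 2 + gz x ^ 2)) hχ01 fun x => by
      rw [abs_of_nonneg (Real.sqrt_nonneg _)]
      exact Real.abs_le_sqrt (by nlinarith [sq_nonneg (gr x)]))
  refine le_trans (le_of_eq ?_) key
  rw [lintegral_muStar]
  refine lintegral_congr_ae ?_
  filter_upwards [(ae_restrict_iff' hD).1 huK] with x hx
  by_cases hxD : x ∈ crossSection R
  · simp only [indicator_of_mem hxD]
    by_cases hxK : x ∈ K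
    · rw [indicator_of_mem hxK]
    · rw [indicator_of_notMem hxK, hx hxD hxK]
  · simp [indicator_of_notMem hxD, hp]

end Slice

/-! ### Interpolation and the two estimates -/

theorem lintegral_rpow_interpolation {α : Type*} [MeasurableSpace α] {μ : Measure α} {f : α → ℝ≥0∞}
    (hf : AEMeasurable f μ) {p q t : ℝ} (hp : 0 ≤ p) (hq : 0 ≤ q) (ht0 : 0 ≤ t) (ht1 : t ≤ 1) :
    ∫⁻ x, f x ^ (p * (1 - t) + q * t) ∂μ ≤
      (∫⁻ x, f x ^ p ∂μ) ^ (1 - t) * (∫⁻ x, f x ^ q ∂μ) ^ t := by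
  have h1t : 0 ≤ 1 - t := by linarith
  refine (le_of_eq (lintegral_congr fun x => ?_)).trans (ENNReal.lintegral_mul_norm_pow_le
    (hf.pow_const p) (hf.pow_const q) h1t ht0 (by ring))
  rw [← ENNReal.rpow_mul, ← ENNReal.rpow_mul,
    ENNReal.rpow_add_of_nonneg _ _ (by positivity) (by positivity)]

/-- Young's inequality by comparing `B` with `k * A`. The threshold satisfies `k ^ (-α) = ε`, so the
case `k * A ≤ B` costs exactly `ε * B`. -/
theorem exists_rpow_mul_rpow_le {α β : ℝ} (hα : 0 < α) (hβ : 0 ≤ β) (hαβ : α + β = 1) {ε : ℝ≥0}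
    (hε : 0 < ε) : ∃ C : ℝ≥0, ∀ A B : ℝ≥0∞, A ^ α * B ^ β ≤ ε * B + C * A := by
  set k : ℝ≥0 := ε ^ (-(1 / α)) with hk
  have hk0 : 0 < k := NNReal.rpow_pos hε
  have hkα : (k⁻¹) ^ α = ε := by
    rw [hk, ← NNReal.rpow_neg, neg_neg, ← NNReal.rpow_mul, one_div_mul_cancel hα.ne',
      NNReal.rpow_one]
  have hself : ∀ X : ℝ≥0∞, X ^ α * X ^ β = X := fun X => by
    rw [← ENNReal.rpow_add_of_nonneg _ _ hα.le hβ, hαβ, ENNReal.rpow_one]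
  refine ⟨k ^ β, fun A B => ?_⟩
  rcases le_total B (k * A) with h | h
  · calc A ^ α * B ^ β ≤ A ^ α * (k * A) ^ β := by gcongr
      _ = (k : ℝ≥0∞) ^ β * (A ^ α * A ^ β) := by
          rw [ENNReal.mul_rpow_of_nonneg _ _ hβ]; ring
      _ = (k ^ β : ℝ≥0) * A := by rw [hself, ENNReal.coe_rpow_of_nonneg _ hβ]
      _ ≤ _ := le_add_self
  · have hA : A ≤ (k⁻¹ : ℝ≥0) * B := by
      calc A = (k⁻¹ : ℝ≥0) * (k * A) := by
            rw [← mul_assoc, ← ENNReal.coe_mul, inv_mul_cancel₀ hk0.ne', ENNReal.coe_one, one_mul]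
        _ ≤ _ := by gcongr
    calc A ^ α * B ^ β ≤ ((k⁻¹ : ℝ≥0) * B) ^ α * B ^ β := by gcongr
      _ = ((k⁻¹ : ℝ≥0) : ℝ≥0∞) ^ α * (B ^ α * B ^ β) := by
          rw [ENNReal.mul_rpow_of_nonneg _ _ hα.le]; ring
      _ = ε * B := by rw [hself, ← ENNReal.coe_rpow_of_nonneg _ hα.le, hkα]
      _ ≤ _ := le_self_add

theorem eLpNorm_two_sq {α : Type*} [MeasurableSpace α] (μ : Measure α) (f : α → ℝ) :
    eLpNorm f 2 μ ^ 2 = ∫⁻ x, ‖f x‖ₑ ^ 2 ∂μ := by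
  rw [eLpNorm_eq_lintegral_rpow_enorm_toReal (by norm_num) (by norm_num), ← ENNReal.rpow_natCast,
    ← ENNReal.rpow_mul]
  simp

theorem eLpNorm_ofReal {α : Type*} [MeasurableSpace α] (μ : Measure α) (f : α → ℝ) {p : ℝ}
    (hp : 0 < p) : eLpNorm f (ENNReal.ofReal p) μ = (∫⁻ x, ‖f x‖ₑ ^ p ∂μ) ^ (1 / p) := by
  rw [eLpNorm_eq_lintegral_rpow_enorm_toReal (by simpa using hp) ENNReal.ofReal_ne_top,
    ENNReal.toReal_ofReal hp.le]

/-- Almost every time slice satisfies the interpolated weighted Sobolev inequality. -/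
theorem ae_lintegral_slice_le {δ R : ℝ} (hδ : 0 < δ) {ψ ψr ψz : ℝ → ℝ × ℝ → ℝ}
    (hψ : EnergyClass δ R ψ ψr ψz) (hK : CompactlySupported R ψ) {t : ℝ} (ht0 : 0 ≤ t)
    (ht1 : t ≤ 1) :
    ∀ᵐ τ ∂(volume.restrict (times R)),
      ∫⁻ x, ‖ψ τ x‖ₑ ^ (2 * (1 - t) + 2 * (aExp δ + 2) / aExp δ * t) ∂(muStar δ R) ≤
        (eLpNorm (ψ τ) 2 (muStar δ R) ^ 2) ^ (1 - t) *
          (ENNReal.ofReal (2 * (aExp δ + 1) / aExp δ) ^ 2 *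
            eLpNorm (gradLength ψr ψz τ) 2 (muStar δ R) ^ 2) ^ ((aExp δ + 2) / aExp δ * t) := by
  have ha : 0 < aExp δ := by unfold aExp; linarith
  obtain ⟨K, hKc, hKs, hψK⟩ := hK
  filter_upwards [hψK, hψ.weak_dr, hψ.weak_dz] with τ h0 hr hz
  have hs := sobolev_crossSection hδ hKc hKs h0 hr hz
  refine (lintegral_rpow_interpolation (aestronglyMeasurable_muStar hr.1).enorm zero_le_two
    (by positivity) ht0 ht1).trans ?_
  rw [eLpNorm_two_sq, eLpNorm_two_sq, ENNReal.rpow_mul]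
  gcongr
  · simp
  · exact hs

theorem two_lt_qstar {δ : ℝ} (hδ : 0 < δ) : 2 < qstar δ := by
  have : 0 < Nstar δ := by unfold Nstar aExp; linarith
  have : 0 < 2 / Nstar δ := by positivity
  unfold qstar
  linarith

theorem aemeasurable_gradLength {δ R : ℝ} {ψ ψr ψz : ℝ → ℝ × ℝ → ℝ}
    (hψ : EnergyClass δ R ψ ψr ψz) :
    AEMeasurable (fun y : ℝ × (ℝ × ℝ) => gradLength ψr ψz y.1 y.2) (muStarTime δ R) :=
  Real.continuous_sqrt.measurable.comp_aemeasurable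
    ((hψ.memLp_dr.aestronglyMeasurable.aemeasurable.pow_const 2).add
      (hψ.memLp_dz.aestronglyMeasurable.aemeasurable.pow_const 2))

/-- Interpolating with `t = a / (a + 2)` produces the power `qstar δ` and makes the squared gradient
norm enter to the first power, so its time integral is finite energy; the remaining `L²` factor is
bounded by the essential supremum. -/
theorem parabolic_embedding {δ R : ℝ} (hδ : 0 < δ) {ψ ψr ψz : ℝ → ℝ × ℝ → ℝ}
    (hψ : EnergyClass δ R ψ ψr ψz) (hK : CompactlySupported R ψ) :
    eLpNorm (fun y : ℝ × (ℝ × ℝ) => ψ y.1 y.2) (ENNReal.ofReal (qstar δ)) (muStarTime δ R) ≤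
      ENNReal.ofReal (2 * (aExp δ + 1) / aExp δ) *
        (essSup (fun t => eLpNorm (ψ t) 2 (muStar δ R)) (volume.restrict (times R)) +
          eLpNorm (fun y : ℝ × (ℝ × ℝ) => gradLength ψr ψz y.1 y.2) 2 (muStarTime δ R)) := by
  have ha : 0 < aExp δ := by unfold aExp; linarith
  have hq2 := two_lt_qstar hδ
  have hq : 0 < qstar δ := by linarith
  set a := aExp δ with ha_def
  set s := ENNReal.ofReal (2 * (a + 1) / a) with hs
  -- Needed to enlarge `s ^ 2` to `s ^ qstar δ`, so that the right side becomes a pure `qstar δ`-th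
  -- power.
  have hs1 : 1 ≤ s := by
    rw [hs, ENNReal.one_le_ofReal, le_div_iff₀ ha]; linarith
  set m := essSup (fun t => eLpNorm (ψ t) 2 (muStar δ R)) (volume.restrict (times R)) with hm
  set γ := eLpNorm (fun y : ℝ × (ℝ × ℝ) => gradLength ψr ψz y.1 y.2) 2 (muStarTime δ R) with hγ
  have hNa : Nstar δ = a + 2 := rfl
  have hqe : qstar δ = 4 / (a + 2) + 2 := by unfold qstar; rw [hNa]; ring
  have ht0 : 0 ≤ a / (a + 2) := by positivity
  have ht1 : a / (a + 2) ≤ 1 := by rw [div_le_one (by positivity)]; linarith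
  have h1t : 1 - a / (a + 2) = 2 / (a + 2) := by field_simp; ring
  have hslice := ae_lintegral_slice_le hδ hψ hK ht0 ht1
  have hexp : 2 * (1 - a / (a + 2)) + 2 * (aExp δ + 2) / aExp δ * (a / (a + 2)) = qstar δ := by
    rw [hqe, h1t, ← ha_def]; field_simp; ring
  have hexp' : (aExp δ + 2) / aExp δ * (a / (a + 2)) = 1 := by rw [← ha_def]; field_simp
  rw [hexp, hexp', h1t] at hslice
  simp only [ENNReal.rpow_one] at hslice
  have hγ2 : γ ^ 2 = ∫⁻ t in times R, eLpNorm (gradLength ψr ψz t) 2 (muStar δ R) ^ 2 := by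
    rw [hγ, eLpNorm_two_sq, muStarTime,
      lintegral_prod _ ((aemeasurable_gradLength hψ).enorm.pow_const 2)]
    simp only [eLpNorm_two_sq]
  have hmain : ∫⁻ y, ‖ψ y.1 y.2‖ₑ ^ qstar δ ∂(muStarTime δ R) ≤ (s * (m + γ)) ^ qstar δ := by
    calc ∫⁻ y, ‖ψ y.1 y.2‖ₑ ^ qstar δ ∂(muStarTime δ R)
        = ∫⁻ t in times R, ∫⁻ x, ‖ψ t x‖ₑ ^ qstar δ ∂(muStar δ R) :=
          lintegral_prod _ (hψ.memLp.aestronglyMeasurable.enorm.pow_const _)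
      _ ≤ ∫⁻ t in times R, m ^ (4 / (a + 2)) * s ^ 2 *
            eLpNorm (gradLength ψr ψz t) 2 (muStar δ R) ^ 2 := by
          refine lintegral_mono_ae ?_
          filter_upwards [hslice, ENNReal.ae_le_essSup
            (fun t => eLpNorm (ψ t) 2 (muStar δ R))] with t ht htm
          refine ht.trans ?_
          rw [← mul_assoc]
          gcongr
          rw [← ENNReal.rpow_natCast, ← ENNReal.rpow_mul]
          calc _ ≤ m ^ (((2 : ℕ) : ℝ) * (2 / (a + 2))) := by gcongr
            _ = _ := by congr 1; push_cast; ring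
      _ = m ^ (4 / (a + 2)) * s ^ 2 * γ ^ 2 := by
          rw [hγ2, lintegral_const_mul'']
          have := ((aemeasurable_gradLength hψ).enorm.pow_const 2).lintegral_prod_right'
          simpa only [eLpNorm_two_sq] using this
      _ ≤ (m + γ) ^ (4 / (a + 2)) * s ^ qstar δ * (m + γ) ^ (2 : ℝ) := by
          gcongr
          · exact le_self_add
          · rw [← ENNReal.rpow_natCast]
            exact ENNReal.rpow_le_rpow_of_exponent_le hs1 (by push_cast; exact hq2.le)
          · rw [← ENNReal.rpow_natCast]
            push_cast
            gcongr
            exact le_add_self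
      _ = (s * (m + γ)) ^ qstar δ := by
          rw [ENNReal.mul_rpow_of_nonneg _ _ hq.le, mul_right_comm,
            ← ENNReal.rpow_add_of_nonneg _ _ (by positivity) zero_le_two, ← hqe, mul_comm]
  rw [eLpNorm_ofReal _ _ hq]
  calc _ ≤ ((s * (m + γ)) ^ qstar δ) ^ (1 / qstar δ) := by gcongr
    _ = s * (m + γ) := by
        rw [← ENNReal.rpow_mul, mul_one_div_cancel hq.ne', ENNReal.rpow_one]

theorem exists_slice_interpolation {δ : ℝ} (hδ : 0 < δ) (R : ℝ) {p : ℝ} (hp2 : 2 ≤ p)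
    (hp : p < 2 * Nstar δ / (Nstar δ - 2)) {ε : ℝ≥0} (hε : 0 < ε) :
    ∃ C : ℝ≥0, ∀ ψ ψr ψz : ℝ → ℝ × ℝ → ℝ,
      EnergyClass δ R ψ ψr ψz → CompactlySupported R ψ →
        ∀ᵐ t ∂(volume.restrict (times R)),
          eLpNorm (ψ t) (ENNReal.ofReal p) (muStar δ R) ^ 2 ≤
            ε * eLpNorm (gradLength ψr ψz t) 2 (muStar δ R) ^ 2 +
              C * eLpNorm (ψ t) 2 (muStar δ R) ^ 2 := by
  have ha : 0 < aExp δ := by unfold aExp; linarith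
  have hp0 : 0 < p := by linarith
  have hNa : Nstar δ = aExp δ + 2 := rfl
  rw [hNa, add_sub_cancel_right] at hp
  set a := aExp δ with ha_def
  -- The interpolation parameter giving the power `p`. The strict upper bound on `p` says `l < 1`,
  -- which leaves a positive power of the `L²` norm for Young's inequality.
  set l := a * (p - 2) / 4 with hl
  have hl0 : 0 ≤ l := div_nonneg (mul_nonneg ha.le (by linarith)) (by norm_num)
  have hl1 : l < 1 := by
    rw [lt_div_iff₀ ha] at hp
    rw [hl, div_lt_one (by norm_num)]
    linarith
  have hexp : 2 * (1 - l) + 2 * (aExp δ + 2) / aExp δ * l = p := by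
    rw [hl, ← ha_def]; field_simp; ring
  set s : ℝ≥0 := Real.toNNReal (2 * (a + 1) / a) with hs
  have hs0 : 0 < s := Real.toNNReal_pos.2 (by positivity)
  have h1l : 0 < 1 - l := by linarith
  have hsum : (1 - l) * (2 / p) + (a + 2) / a * l * (2 / p) = 1 := by
    rw [← add_mul]
    have : (1 - l) + (a + 2) / a * l = p / 2 := by rw [hl]; field_simp; ring
    rw [this]; field_simp
  -- Dividing by `s ^ 2` compensates the Sobolev constant multiplying the gradient term.
  obtain ⟨C, hC⟩ := exists_rpow_mul_rpow_le (α := (1 - l) * (2 / p))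
    (β := (a + 2) / a * l * (2 / p)) (by positivity) (by positivity) hsum
    (ε := ε / s ^ 2) (by positivity)
  refine ⟨C, fun ψ ψr ψz hψ hK => ?_⟩
  filter_upwards [ae_lintegral_slice_le hδ hψ hK hl0 hl1.le] with t ht
  rw [hexp] at ht
  set A := eLpNorm (ψ t) 2 (muStar δ R) ^ 2
  set G := eLpNorm (gradLength ψr ψz t) 2 (muStar δ R) ^ 2
  calc eLpNorm (ψ t) (ENNReal.ofReal p) (muStar δ R) ^ 2
      = (∫⁻ x, ‖ψ t x‖ₑ ^ p ∂(muStar δ R)) ^ (2 / p) := by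
        rw [eLpNorm_ofReal _ _ hp0, ← ENNReal.rpow_natCast, ← ENNReal.rpow_mul]
        congr 1; push_cast; ring
    _ ≤ (A ^ (1 - l) * ((s : ℝ≥0∞) ^ 2 * G) ^ ((a + 2) / a * l)) ^ (2 / p) := by
        gcongr
        exact ht
    _ = A ^ ((1 - l) * (2 / p)) * ((s : ℝ≥0∞) ^ 2 * G) ^ ((a + 2) / a * l * (2 / p)) := by
        rw [ENNReal.mul_rpow_of_nonneg _ _ (by positivity), ← ENNReal.rpow_mul,
          ← ENNReal.rpow_mul]
    _ ≤ (ε / s ^ 2 : ℝ≥0) * ((s : ℝ≥0∞) ^ 2 * G) + C * A := hC _ _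
    _ = ε * G + C * A := by
        rw [← mul_assoc, ← ENNReal.coe_pow, ← ENNReal.coe_mul,
          div_mul_cancel₀ _ (by positivity : s ^ 2 ≠ 0)]

end RenormalizedGeometry

end

open RenormalizedGeometry in
theorem mainTheorem6 (δ : ℝ) (hδ : 0 < δ) :
    2 < qstar δ ∧
    (∃ C : ℝ≥0, ∀ R : ℝ, 0 < R → ∀ ψ ψr ψz : ℝ → ℝ × ℝ → ℝ,
      EnergyClass δ R ψ ψr ψz → CompactlySupported R ψ →
        eLpNorm (fun y : ℝ × (ℝ × ℝ) => ψ y.1 y.2) (ENNReal.ofReal (qstar δ)) (muStarTime δ R) ≤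
          C * (essSup (fun t => eLpNorm (ψ t) 2 (muStar δ R)) (volume.restrict (times R)) +
            eLpNorm (fun y : ℝ × (ℝ × ℝ) => gradLength ψr ψz y.1 y.2) 2 (muStarTime δ R))) ∧
    (∀ R : ℝ, 0 < R → ∀ p : ℝ, 2 ≤ p → p < 2 * Nstar δ / (Nstar δ - 2) →
      ∀ ε : ℝ≥0, 0 < ε → ∃ C : ℝ≥0, ∀ ψ ψr ψz : ℝ → ℝ × ℝ → ℝ,
        EnergyClass δ R ψ ψr ψz → CompactlySupported R ψ →
          ∀ᵐ t ∂(volume.restrict (times R)),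
            eLpNorm (ψ t) (ENNReal.ofReal p) (muStar δ R) ^ 2 ≤
              ε * eLpNorm (gradLength ψr ψz t) 2 (muStar δ R) ^ 2 +
                C * eLpNorm (ψ t) 2 (muStar δ R) ^ 2) := by
  refine ⟨two_lt_qstar hδ, ⟨Real.toNNReal (2 * (aExp δ + 1) / aExp δ), ?_⟩, ?_⟩
  · intro R _ ψ ψr ψz hψ hK
    exact parabolic_embedding hδ hψ hK
  · intro R _ p hp2 hp ε hε
    exact exists_slice_interpolation hδ R hp2 hp hε
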